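/- Fix countably many propositional variables. Let $\mathcal L(\Box,\rhd)$-formulas be given by $A ::= \bot \mid p \mid A\to A \mid \Box A \mid A\rhd A$ and $\mathcal L(\Box,\mathsf I)$-formulas by $A ::= \bot \mid p \mid A\to A \mid \Box A \mid \mathsf I A$; the connectives $\top,\neg,\land,\lor,\leftrightarrow$ are defined as usual and $\Diamond A := \neg\Box\neg A$. Every $\mathcal L(\Box,\mathsf I)$-formula is read as an $\mathcal L(\Box,\rhd)$-formula by letting $\mathsf I A$ abbreviate $\top\rhd A$. The logic $\mathbf{IL}^-$ has as axioms all $\mathcal L(\Box,\rhd)$-tautologies, $\Box(A\to B)\to(\Box A\to\Box B)$, $\Box(\Box A\to A)\to\Box A$, $\mathbf{J3}$: $(A\rhd C)\land(B\rhd C)\to(A\lor B)\rhd C$, and $\mathbf{J6}$: $\Box A\leftrightarrow(\neg A\rhd\bot)$; its rules are Modus Ponens, Necessitation, from $A\to B$ infer $(C\rhd A)\to(C\rhd B)$, and from $A\to B$ infer $(B\rhd C)\to(A\rhd C)$. Consider the schemata - $\mathbf{J1}$: $\Box(A\to B)\to A\rhd B$; - $\mathbf{J2}$: $(A\rhd B)\land(B\rhd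 C)\to A\rhd C$; - $\mathbf{J2}_+$: $(A\rhd(B\lor C))\land(B\rhd C)\to A\rhd C$; - $\mathbf{J4}$: $A\rhd B\to(\Diamond A\to\Diamond B)$; - $\mathbf{J4}_+$: $\Box(A\to B)\to(C\rhd A\to C\rhd B)$; - $\mathbf{J5}$: $\Diamond A\rhd A$. The logic $\mathbf{CL}$ has as axioms all $\mathcal L(\Box,\rhd)$-tautologies, $\Box(A\to B)\to(\Box A\to\Box B)$, $\Box(\Box A\to A)\to\Box A$, $\mathbf{J1}$, $\mathbf{J2}$, $\mathbf{J3}$ and $\mathbf{J4}$, and the rules Modus Ponens and Necessitation. The logic $\mathbf{il}^-$ has as axioms all $\mathcal L(\Box,\mathsf I)$-tautologies, $\Box(A\to B)\to(\Box A\to\Box B)$, $\Box(\Box A\to A)\to\Box A$, and $\Box\bot\leftrightarrow\mathsf I\bot$; its rules are Modus Ponens, Necessitation, and from $A\to B$ infer $\mathsf I A\to\mathsf I B$. Consider also the schemata $\mathbf{J1}'$: $\Box A\to\mathsf I A$ and $\mathbf{I2}$: $\Box(A\to B)\to(\mathsf I A\to\mathsf I B)$. For a logic $M$ and schemata $\Sigma_1,\dots,\Sigma_k$,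 $M(\Sigma_1,\dots,\Sigma_k)$ is $M$ with these schemata added as axioms (its rules then apply to the extended system). A logic is identified with its set of theorems, and $L\vdash A$ means $A\in L$. **Statement.** Let $A$ be any $\mathcal L(\Box,\mathsf I)$-formula, and let $L$ be any set of $\mathcal L(\Box,\rhd)$-formulas (in particular, any logic). 1. If $\mathbf{IL}^-\subseteq L\subseteq\mathbf{IL}^-(\mathbf{J5})$, then $L\vdash A$ if and only if $\mathbf{il}^-\vdash A$. 2. If $\mathbf{IL}^-(\mathbf{J4}_+)\subseteq L\subseteq\mathbf{IL}^-(\mathbf{J4}_+,\mathbf{J5})$ or $\mathbf{IL}^-(\mathbf{J4}_+)\subseteq L\subseteq\mathbf{IL}^-(\mathbf{J2}_+)$, then $L\vdash A$ if and only if $\mathbf{il}^-(\mathbf{I2})\vdash A$. 3. If $\mathbf{IL}^-(\mathbf{J1},\mathbf{J4}_+)\subseteq L\subseteq\mathbf{CL}$, then $L\vdash A$ if and only if $\mathbf{il}^-(\mathbf{J1}',\mathbf{I2})\vdash A$. -/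

import Mathlib

namespace IntLogic

/-! ### The language with `□` and `▷` -/

/-- Formulas `A ::= ⊥ | p | A → A | □ A | A ▷ A` over countably many variables. -/
inductive BFormula : Type
  | bot : BFormula
  | var : ℕ → BFormula
  | imp : BFormula → BFormula → BFormula
  | box : BFormula → BFormula
  | rhd : BFormula → BFormula → BFormula

namespace BFormula

def neg (A : BFormula) : BFormula := A.imp bot

def top : BFormula := bot.imp bot

def or (A B : BFormula) : BFormula := A.neg.imp B

def and (A B : BFormula) : BFormula := (A.imp B.neg).neg

def iff (A B : BFormula) : BFormula := (A.imp B).and (B.imp A)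

def dia (A : BFormula) : BFormula := A.neg.box.neg

/-- `A` is true under every assignment of truth values to formulas that respects `⊥` and `→`
(formulas `□ B` and `B ▷ C` are treated as atoms). -/
def IsTautology (A : BFormula) : Prop :=
  ∀ v : BFormula → Prop, ¬ v bot → (∀ B C, v (B.imp C) ↔ (v B → v C)) → v A

end BFormula

/-! Axiom schemata, each given as the set of its instances. -/

/-- All tautologies. -/
def G1 : Set BFormula := {F | F.IsTautology}

/-- `□(A → B) → (□A → □B)` -/
def G2 : Set BFormula := {F | ∃ A B : BFormula, F = (A.imp B).box.imp (A.box.imp B.box)}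

/-- `□(□A → A) → □A` -/
def G3 : Set BFormula := {F | ∃ A : BFormula, F = (A.box.imp A).box.imp A.box}

/-- `□(A → B) → A ▷ B` -/
def J1 : Set BFormula := {F | ∃ A B : BFormula, F = (A.imp B).box.imp (A.rhd B)}

/-- `(A ▷ B) ∧ (B ▷ C) → A ▷ C` -/
def J2 : Set BFormula :=
  {F | ∃ A B C : BFormula, F = ((A.rhd B).and (B.rhd C)).imp (A.rhd C)}

/-- `(A ▷ (B ∨ C)) ∧ (B ▷ C) → A ▷ C` -/
def J2plus : Set BFormula :=
  {F | ∃ A B C : BFormula, F = ((A.rhd (B.or C)).and (B.rhd C)).imp (A.rhd C)}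

/-- `(A ▷ C) ∧ (B ▷ C) → (A ∨ B) ▷ C` -/
def J3 : Set BFormula :=
  {F | ∃ A B C : BFormula, F = ((A.rhd C).and (B.rhd C)).imp ((A.or B).rhd C)}

/-- `A ▷ B → (◇A → ◇B)` -/
def J4 : Set BFormula := {F | ∃ A B : BFormula, F = (A.rhd B).imp (A.dia.imp B.dia)}

/-- `□(A → B) → (C ▷ A → C ▷ B)` -/
def J4plus : Set BFormula :=
  {F | ∃ A B C : BFormula, F = (A.imp B).box.imp ((C.rhd A).imp (C.rhd B))}

/-- `◇A ▷ A` -/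
def J5 : Set BFormula := {F | ∃ A : BFormula, F = A.dia.rhd A}

/-- `□A ↔ (¬A ▷ ⊥)` -/
def J6 : Set BFormula := {F | ∃ A : BFormula, F = A.box.iff (A.neg.rhd BFormula.bot)}

/-- `ILMinus X` is the set of theorems of the logic `IL⁻(X)`: axioms `G1`, `G2`, `G3`, `J3`, `J6`
and the instances in `X`; rules Modus Ponens, Necessitation, `R1` and `R2`. -/
inductive ILMinus (X : Set BFormula) : Set BFormula
  | base {A : BFormula} (h : A ∈ G1 ∪ G2 ∪ G3 ∪ J3 ∪ J6) : ILMinus X A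
  | extra {A : BFormula} (h : A ∈ X) : ILMinus X A
  | mp {A B : BFormula} (h₁ : ILMinus X A) (h₂ : ILMinus X (A.imp B)) : ILMinus X B
  | nec {A : BFormula} (h : ILMinus X A) : ILMinus X A.box
  | r1 {A B : BFormula} (C : BFormula) (h : ILMinus X (A.imp B)) :
      ILMinus X ((C.rhd A).imp (C.rhd B))
  | r2 {A B : BFormula} (C : BFormula) (h : ILMinus X (A.imp B)) :
      ILMinus X ((B.rhd C).imp (A.rhd C))

/-- The set of theorems of the conservativity logic `CL`: axioms `G1`, `G2`, `G3`, `J1`, `J2`,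
`J3`, `J4` (those of `IL` without `J5`); rules Modus Ponens and Necessitation. -/
inductive CL : Set BFormula
  | ax {A : BFormula} (h : A ∈ G1 ∪ G2 ∪ G3 ∪ J1 ∪ J2 ∪ J3 ∪ J4) : CL A
  | mp {A B : BFormula} (h₁ : CL A) (h₂ : CL (A.imp B)) : CL B
  | nec {A : BFormula} (h : CL A) : CL A.box

/-! ### The language with `□` and the unary operator `I` -/

/-- Formulas `A ::= ⊥ | p | A → A | □ A | I A` over the same variables. -/
inductive UFormula : Type
  | bot : UFormula
  | var : ℕ → UFormula
  | imp : UFormula → UFormula → UFormula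
  | box : UFormula → UFormula
  | int : UFormula → UFormula

namespace UFormula

def neg (A : UFormula) : UFormula := A.imp bot

def and (A B : UFormula) : UFormula := (A.imp B.neg).neg

def iff (A B : UFormula) : UFormula := (A.imp B).and (B.imp A)

/-- `A` is true under every assignment of truth values to formulas that respects `⊥` and `→`
(formulas `□ B` and `I B` are treated as atoms). -/
def IsTautology (A : UFormula) : Prop :=
  ∀ v : UFormula → Prop, ¬ v bot → (∀ B C, v (B.imp C) ↔ (v B → v C)) → v A

/-- The formula with `□` and `▷` that `A` abbreviates: `I B` stands for `⊤ ▷ B`. -/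
def toB : UFormula → BFormula
  | bot => BFormula.bot
  | var n => BFormula.var n
  | imp A B => A.toB.imp B.toB
  | box A => A.toB.box
  | int A => BFormula.top.rhd A.toB

end UFormula

/-- All tautologies of the unary language. -/
def uG1 : Set UFormula := {F | F.IsTautology}

/-- `□(A → B) → (□A → □B)` -/
def uG2 : Set UFormula := {F | ∃ A B : UFormula, F = (A.imp B).box.imp (A.box.imp B.box)}

/-- `□(□A → A) → □A` -/
def uG3 : Set UFormula := {F | ∃ A : UFormula, F = (A.box.imp A).box.imp A.box}

/-- `□⊥ ↔ I⊥` -/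
def uJ6 : Set UFormula := {UFormula.bot.box.iff UFormula.bot.int}

/-- `□A → I A` -/
def uJ1 : Set UFormula := {F | ∃ A : UFormula, F = A.box.imp A.int}

/-- `□(A → B) → (I A → I B)` -/
def I2 : Set UFormula := {F | ∃ A B : UFormula, F = (A.imp B).box.imp (A.int.imp B.int)}

/-- `ilMinus X` is the set of theorems of the unary logic `il⁻(X)`: axioms `uG1`, `uG2`, `uG3`,
`uJ6` and the instances in `X`; rules Modus Ponens, Necessitation, and from `A → B` infer
`I A → I B`. -/
inductive ilMinus (X : Set UFormula) : Set UFormula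
  | base {A : UFormula} (h : A ∈ uG1 ∪ uG2 ∪ uG3 ∪ uJ6) : ilMinus X A
  | extra {A : UFormula} (h : A ∈ X) : ilMinus X A
  | mp {A B : UFormula} (h₁ : ilMinus X A) (h₂ : ilMinus X (A.imp B)) : ilMinus X B
  | nec {A : UFormula} (h : ilMinus X A) : ilMinus X A.box
  | r {A B : UFormula} (h : ilMinus X (A.imp B)) : ilMinus X (A.int.imp B.int)

end IntLogic

/-!
If `I` is read as `⊤ ▷ ·`, every axiom and rule of the unary logics is derivable in the
corresponding binary logic, so only the upper bounds need an idea.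

For these, interpret `A ▷ B` in the unary language as `□(A → σB) ∨ I B`, where `σB` is `◇B` for
`IL⁻(J5)` and `IL⁻(J4₊, J5)`, `⊥` for `IL⁻(J2₊)`, and `B` for `CL`. Each extra schema becomes
provable by a simple property of `σ`. Moreover `⊤ ▷ B` collapses to `I B` because `□σB → I B`: this
is `J1'` when `σB = B`, and otherwise Löb's axiom gives `□◇B → □⊥`, while `□⊥ → I⊥ → I B`.
Interpreting a proof of the reading of `A` therefore yields a proof of a formula equivalent to `A`.
-/

namespace IntLogic

theorem UFormula.IsTautology.toB {A : UFormula} (h : A.IsTautology) : A.toB.IsTautology :=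
  fun v v_bot v_imp ↦ h (fun F ↦ v F.toB) v_bot fun _ _ ↦ v_imp _ _

namespace ILMinus

variable {X : Set UFormula} {Y : Set BFormula}

theorem of_isTautology {A : BFormula} (h : A.IsTautology) : ILMinus Y A :=
  .base (.inl (.inl (.inl (.inl h))))

theorem box_imp (A B : BFormula) : ILMinus Y ((A.imp B).box.imp (A.box.imp B.box)) :=
  .base (.inl (.inl (.inl (.inr ⟨A, B, rfl⟩))))

theorem loeb (A : BFormula) : ILMinus Y ((A.box.imp A).box.imp A.box) :=
  .base (.inl (.inl (.inr ⟨A, rfl⟩)))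

theorem box_mono {A B : BFormula} (h : ILMinus Y (A.imp B)) : ILMinus Y (A.box.imp B.box) :=
  .mp (.nec h) (box_imp A B)

theorem imp_trans {A B C : BFormula} (hAB : ILMinus Y (A.imp B)) (hBC : ILMinus Y (B.imp C)) :
    ILMinus Y (A.imp C) :=
  .mp hBC <| .mp hAB <| of_isTautology fun v _ v_imp ↦ by
    simp only [v_imp]
    exact fun hAB hBC hA ↦ hBC (hAB hA)

theorem toB_of_ilMinus (hX : ∀ A ∈ X, ILMinus Y A.toB) {A : UFormula} (hA : ilMinus X A) :
    ILMinus Y A.toB := by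
  induction hA with
  | base h =>
    rcases h with ((taut | ⟨A, B, rfl⟩) | ⟨A, rfl⟩) | rfl
    · exact of_isTautology taut.toB
    · exact box_imp A.toB B.toB
    · exact loeb A.toB
    · exact .base (.inr ⟨.bot, rfl⟩)
  | extra h => exact hX _ h
  | mp _ _ ihA ihAB => exact .mp ihA ihAB
  | nec _ ih => exact .nec ih
  | r _ ih => exact .r1 _ ih

theorem toB_I2 (hY : J4plus ⊆ Y) {A : UFormula} (hA : A ∈ I2) : ILMinus Y A.toB := by
  obtain ⟨A, B, rfl⟩ := hA
  exact .extra (hY ⟨_, _, _, rfl⟩)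

theorem toB_uJ1 (hY : J1 ⊆ Y) {A : UFormula} (hA : A ∈ uJ1) : ILMinus Y A.toB := by
  obtain ⟨A, rfl⟩ := hA
  have weaken : ILMinus Y (A.toB.imp (BFormula.top.imp A.toB)) :=
    of_isTautology fun v _ v_imp ↦ by
      simp only [v_imp]
      exact fun hA _ ↦ hA
  have rhd_of_box : ILMinus Y ((BFormula.top.imp A.toB).box.imp (BFormula.top.rhd A.toB)) :=
    .extra (hY ⟨_, _, rfl⟩)
  exact (box_mono weaken).imp_trans rhd_of_box

end ILMinus

theorem CL.toILMinus {A : BFormula} (hA : CL A) : ILMinus (J1 ∪ J2 ∪ J4) A := by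
  induction hA with
  | ax h =>
    rcases h with (((((taut | ⟨A, B, rfl⟩) | ⟨A, rfl⟩) | h) | h) | h) | h
    · exact .of_isTautology taut
    · exact .box_imp A B
    · exact .loeb A
    · exact .extra (.inl (.inl h))
    · exact .extra (.inl (.inr h))
    · exact .base (.inl (.inr h))
    · exact .extra (.inr h)
  | mp _ _ ihA ihAB => exact .mp ihA ihAB
  | nec _ ih => exact .nec ih

namespace UFormula

/-- The unary counterpart of `BFormula.top`, built in the same way so that translating formulas
commutes with it definitionally; likewise `or` and `dia` below. -/
def top : UFormula := bot.imp bot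

/-- Disjunction, the unary counterpart of `BFormula.or`. -/
def or (A B : UFormula) : UFormula := A.neg.imp B

/-- The possibility operator `◇`, the unary counterpart of `BFormula.dia`. -/
def dia (A : UFormula) : UFormula := A.neg.box.neg

end UFormula

/-- A truth assignment as quantified over in `UFormula.IsTautology`: it respects `⊥` and `→`, and
treats `□ A` and `I A` as atoms. -/
structure Valuation where
  Holds : UFormula → Prop
  not_holds_bot : ¬ Holds .bot
  holds_imp : ∀ A B, Holds (A.imp B) ↔ (Holds A → Holds B)

namespace Valuation

variable (v : Valuation) (A B : UFormula)

attribute [grind .] not_holds_bot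
attribute [grind =] holds_imp

@[grind =]
theorem holds_neg : v.Holds A.neg ↔ ¬ v.Holds A := by grind [UFormula.neg]

@[grind .]
theorem holds_top : v.Holds .top := by grind [UFormula.top]

@[grind =]
theorem holds_and : v.Holds (A.and B) ↔ v.Holds A ∧ v.Holds B := by grind [UFormula.and]

@[grind =]
theorem holds_or : v.Holds (A.or B) ↔ v.Holds A ∨ v.Holds B := by grind [UFormula.or]

@[grind =]
theorem holds_iff : v.Holds (A.iff B) ↔ (v.Holds A ↔ v.Holds B) := by grind [UFormula.iff]

@[grind =]
theorem holds_dia : v.Holds A.dia ↔ ¬ v.Holds A.neg.box := by grind [UFormula.dia]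

end Valuation

namespace ilMinus

variable {X : Set UFormula} {A B C : UFormula}

theorem of_valid (h : ∀ v : Valuation, v.Holds A) : ilMinus X A :=
  .base (.inl (.inl (.inl fun v v_bot v_imp ↦ h ⟨v, v_bot, v_imp⟩)))

theorem of_entails (hA : ilMinus X A) (h : ∀ v : Valuation, v.Holds A → v.Holds B) :
    ilMinus X B :=
  .mp hA (of_valid fun v ↦ (v.holds_imp A B).2 (h v))

theorem and (hA : ilMinus X A) (hB : ilMinus X B) : ilMinus X (A.and B) :=
  .mp hB (of_entails hA fun v ↦ by grind)

theorem imp_trans (hAB : ilMinus X (A.imp B)) (hBC : ilMinus X (B.imp C)) :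
    ilMinus X (A.imp C) :=
  of_entails (hAB.and hBC) fun v ↦ by grind

theorem imp_congr {A' B' : UFormula} (hA : ilMinus X (A.iff A')) (hB : ilMinus X (B.iff B')) :
    ilMinus X ((A.imp B).iff (A'.imp B')) :=
  of_entails (hA.and hB) fun v ↦ by grind

theorem iff_refl (A : UFormula) : ilMinus X (A.iff A) :=
  of_valid fun v ↦ by grind

theorem iff_trans (hAB : ilMinus X (A.iff B)) (hBC : ilMinus X (B.iff C)) :
    ilMinus X (A.iff C) :=
  of_entails (hAB.and hBC) fun v ↦ by grind

theorem iff_intro (hAB : ilMinus X (A.imp B)) (hBA : ilMinus X (B.imp A)) :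
    ilMinus X (A.iff B) :=
  of_entails (hAB.and hBA) fun v ↦ by grind

theorem imp_of_iff (h : ilMinus X (A.iff B)) : ilMinus X (A.imp B) :=
  of_entails h fun v ↦ by grind

theorem imp_of_iff_symm (h : ilMinus X (A.iff B)) : ilMinus X (B.imp A) :=
  of_entails h fun v ↦ by grind

theorem bot_imp (A : UFormula) : ilMinus X (UFormula.bot.imp A) :=
  of_valid fun v ↦ by grind

theorem box_imp (A B : UFormula) : ilMinus X ((A.imp B).box.imp (A.box.imp B.box)) :=
  .base (.inl (.inl (.inr ⟨A, B, rfl⟩)))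

theorem loeb (A : UFormula) : ilMinus X ((A.box.imp A).box.imp A.box) :=
  .base (.inl (.inr ⟨A, rfl⟩))

theorem box_bot_iff_int_bot : ilMinus X (UFormula.bot.box.iff UFormula.bot.int) :=
  .base (.inr rfl)

theorem box_mono (h : ilMinus X (A.imp B)) : ilMinus X (A.box.imp B.box) :=
  .mp (.nec h) (box_imp A B)

theorem box_mono₂ (h : ilMinus X (A.imp (B.imp C))) :
    ilMinus X (A.box.imp (B.box.imp C.box)) :=
  (box_mono h).imp_trans (box_imp B C)

theorem box_congr (h : ilMinus X (A.iff B)) : ilMinus X (A.box.iff B.box) :=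
  iff_intro (box_mono (imp_of_iff h)) (box_mono (imp_of_iff_symm h))

theorem int_congr (h : ilMinus X (A.iff B)) : ilMinus X (A.int.iff B.int) :=
  iff_intro (.r (imp_of_iff h)) (.r (imp_of_iff_symm h))

theorem box_of_int_bot (A : UFormula) : ilMinus X (UFormula.bot.int.imp A.box) :=
  (imp_of_iff_symm box_bot_iff_int_bot).imp_trans (box_mono (bot_imp A))

theorem int_of_box_bot (A : UFormula) : ilMinus X (UFormula.bot.box.imp A.int) :=
  (imp_of_iff box_bot_iff_int_bot).imp_trans (.r (bot_imp A))

theorem box_box (A : UFormula) : ilMinus X (A.box.imp A.box.box) := by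
  -- Löb's axiom is applied to `A ∧ □A`.
  have box_left : ilMinus X ((A.and A.box).box.imp A.box) :=
    box_mono (of_valid fun v ↦ by grind)
  have box_right : ilMinus X ((A.and A.box).box.imp A.box.box) :=
    box_mono (of_valid fun v ↦ by grind)
  have loeb_premise : ilMinus X (A.box.imp ((A.and A.box).box.imp (A.and A.box)).box) :=
    box_mono (of_entails box_left fun v ↦ by grind)
  exact (loeb_premise.imp_trans (loeb _)).imp_trans box_right

theorem dia_of_box_imp (A B : UFormula) : ilMinus X ((A.imp B).box.imp (A.dia.imp B.dia)) := by
  have contrapose : ilMinus X ((A.imp B).box.imp (B.neg.box.imp A.neg.box)) :=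
    box_mono₂ (of_valid fun v ↦ by grind)
  exact of_entails contrapose fun v ↦ by grind

theorem dia_mono (h : ilMinus X (A.imp B)) : ilMinus X (A.dia.imp B.dia) :=
  .mp (.nec h) (dia_of_box_imp A B)

theorem box_dia_of_box_imp (A B : UFormula) :
    ilMinus X ((A.imp B).box.imp (A.dia.imp B.dia).box) :=
  (box_box (A.imp B)).imp_trans (box_mono (dia_of_box_imp A B))

theorem not_dia_bot : ilMinus X UFormula.bot.dia.neg :=
  of_entails (.nec (A := UFormula.bot.neg) (bot_imp .bot)) fun v ↦ by grind

theorem box_bot_of_box_dia (A : UFormula) : ilMinus X (A.dia.box.imp UFormula.bot.box) := by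
  have not_box_bot : ilMinus X (A.dia.imp (UFormula.bot.box.imp .bot)) :=
    of_entails (box_mono (bot_imp A.neg)) fun v ↦ by grind
  exact (box_mono not_box_bot).imp_trans (loeb .bot)

theorem int_of_box_imp (hX : I2 ⊆ X) (A B : UFormula) :
    ilMinus X ((A.imp B).box.imp (A.int.imp B.int)) :=
  .extra (hX ⟨A, B, rfl⟩)

theorem int_of_box (hX : uJ1 ⊆ X) (A : UFormula) : ilMinus X (A.box.imp A.int) :=
  .extra (hX ⟨A, rfl⟩)

end ilMinus

/-- The translation into the unary language that reads `A ▷ B` as `τ A B`. -/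
def BFormula.toU (τ : UFormula → UFormula → UFormula) : BFormula → UFormula
  | bot => .bot
  | var n => .var n
  | imp A B => (A.toU τ).imp (B.toU τ)
  | box A => (A.toU τ).box
  | rhd A B => τ (A.toU τ) (B.toU τ)

theorem BFormula.IsTautology.toU (τ : UFormula → UFormula → UFormula) {A : BFormula}
    (h : A.IsTautology) : (A.toU τ).IsTautology :=
  fun v v_bot v_imp ↦ h (fun F ↦ v (F.toU τ)) v_bot fun _ _ ↦ v_imp _ _

theorem ilMinus.toU_toB_iff {X : Set UFormula} {τ : UFormula → UFormula → UFormula}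
    (hτ : ∀ B, ilMinus X ((τ .top B).iff B.int)) (A : UFormula) :
    ilMinus X ((A.toB.toU τ).iff A) := by
  induction A with
  | bot => exact .iff_refl _
  | var n => exact .iff_refl _
  | imp A B ihA ihB => exact .imp_congr ihA ihB
  | box A ih => exact .box_congr ih
  | int A ih => exact (hτ (A.toB.toU τ)).iff_trans (.int_congr ih)

/-- The interpretation `□(A → σB) ∨ I B` of `A ▷ B` determined by an operator `σ` on formulas. -/
def boxRhd (σ : UFormula → UFormula) (A B : UFormula) : UFormula := (A.imp (σ B)).box.or B.int

@[grind =]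
theorem Valuation.holds_boxRhd (v : Valuation) (σ : UFormula → UFormula) (A B : UFormula) :
    v.Holds (boxRhd σ A B) ↔ v.Holds (A.imp (σ B)).box ∨ v.Holds B.int :=
  v.holds_or _ _

namespace ilMinus

variable {X : Set UFormula} {σ : UFormula → UFormula}

theorem boxRhd_top_iff {B : UFormula} (hσ : ilMinus X ((σ B).box.imp B.int)) :
    ilMinus X ((boxRhd σ .top B).iff B.int) := by
  have box_of_top : ilMinus X ((UFormula.top.imp (σ B)).box.imp (σ B).box) :=
    box_mono (of_valid fun v ↦ by grind)
  exact of_entails (box_of_top.imp_trans hσ) fun v ↦ by grind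

theorem boxRhd_or_left (A B C : UFormula) :
    ilMinus X (((boxRhd σ A C).and (boxRhd σ B C)).imp (boxRhd σ (A.or B) C)) := by
  have box_or : ilMinus X ((A.imp (σ C)).box.imp
      ((B.imp (σ C)).box.imp ((A.or B).imp (σ C)).box)) :=
    box_mono₂ (of_valid fun v ↦ by grind)
  exact of_entails box_or fun v ↦ by grind

theorem box_iff_boxRhd_bot (hσ : ilMinus X (σ .bot).neg) (A : UFormula) :
    ilMinus X (A.box.iff (boxRhd σ A.neg .bot)) := by
  have box_iff : ilMinus X (A.box.iff (A.neg.imp (σ .bot)).box) :=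
    box_congr (of_entails hσ fun v ↦ by grind)
  exact of_entails (box_iff.and (box_of_int_bot A)) fun v ↦ by grind

theorem boxRhd_mono_right {A B : UFormula} (hσ : ilMinus X ((σ A).imp (σ B)))
    (h : ilMinus X (A.imp B)) (C : UFormula) :
    ilMinus X ((boxRhd σ C A).imp (boxRhd σ C B)) := by
  have box_right : ilMinus X ((C.imp (σ A)).box.imp (C.imp (σ B)).box) :=
    box_mono (of_entails hσ fun v ↦ by grind)
  exact of_entails (box_right.and (.r h)) fun v ↦ by grind

theorem boxRhd_anti_left {A B : UFormula} (h : ilMinus X (A.imp B)) (C : UFormula) :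
    ilMinus X ((boxRhd σ B C).imp (boxRhd σ A C)) := by
  have box_left : ilMinus X ((B.imp (σ C)).box.imp (A.imp (σ C)).box) :=
    box_mono (of_entails h fun v ↦ by grind)
  exact of_entails box_left fun v ↦ by grind

theorem boxRhd_of_box_imp (A : UFormula) {B : UFormula} (hσ : ilMinus X (B.imp (σ B))) :
    ilMinus X ((A.imp B).box.imp (boxRhd σ A B)) := by
  have box_right : ilMinus X ((A.imp B).box.imp (A.imp (σ B)).box) :=
    box_mono (of_entails hσ fun v ↦ by grind)
  exact of_entails box_right fun v ↦ by grind

theorem boxRhd_trans (hX : I2 ⊆ X) (A : UFormula) {B C : UFormula}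
    (hB : ilMinus X ((σ B).imp B)) (hC : ilMinus X ((σ C).imp C)) :
    ilMinus X (((boxRhd σ A B).and (boxRhd σ B C)).imp (boxRhd σ A C)) := by
  have box_trans : ilMinus X ((A.imp (σ B)).box.imp ((B.imp (σ C)).box.imp (A.imp (σ C)).box)) :=
    box_mono₂ (of_entails hB fun v ↦ by grind)
  have int_trans : ilMinus X ((B.imp (σ C)).box.imp (B.int.imp C.int)) :=
    (box_mono (of_entails hC fun v ↦ by grind)).imp_trans (int_of_box_imp hX B C)
  exact of_entails (box_trans.and int_trans) fun v ↦ by grind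

theorem boxRhd_trans_or (hX : I2 ⊆ X) (A : UFormula) {B C : UFormula}
    (hB : ilMinus X ((σ B).imp B)) (hC : ilMinus X ((σ C).imp C))
    (hBC : ilMinus X ((σ (B.or C)).imp ((σ B).or (σ C)))) :
    ilMinus X (((boxRhd σ A (B.or C)).and (boxRhd σ B C)).imp (boxRhd σ A C)) := by
  have box_trans : ilMinus X ((A.imp (σ (B.or C))).box.imp
      ((B.imp (σ C)).box.imp (A.imp (σ C)).box)) :=
    box_mono₂ (of_entails (hB.and hBC) fun v ↦ by grind)
  have int_trans : ilMinus X ((B.imp (σ C)).box.imp ((B.or C).int.imp C.int)) :=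
    (box_mono (of_entails hC fun v ↦ by grind)).imp_trans (int_of_box_imp hX (B.or C) C)
  exact of_entails (box_trans.and int_trans) fun v ↦ by grind

theorem dia_of_boxRhd (hX : I2 ⊆ X) (A : UFormula) {B : UFormula} (hσ : ilMinus X ((σ B).imp B)) :
    ilMinus X ((boxRhd σ A B).imp (A.dia.imp B.dia)) := by
  have of_box : ilMinus X ((A.imp (σ B)).box.imp (A.dia.imp B.dia)) :=
    (box_mono (of_entails hσ fun v ↦ by grind)).imp_trans (dia_of_box_imp A B)
  have of_int : ilMinus X (B.neg.box.imp (B.int.imp A.neg.box)) :=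
    of_entails ((int_of_box_imp hX B .bot).and (box_of_int_bot A.neg)) fun v ↦ by
      grind [UFormula.neg]
  exact of_entails (of_box.and of_int) fun v ↦ by grind

theorem boxRhd_right_of_box_imp (hX : I2 ⊆ X) {A B : UFormula}
    (hσ : ilMinus X ((A.imp B).box.imp ((σ A).imp (σ B)).box)) (C : UFormula) :
    ilMinus X ((A.imp B).box.imp ((boxRhd σ C A).imp (boxRhd σ C B))) := by
  have box_right : ilMinus X (((σ A).imp (σ B)).box.imp
      ((C.imp (σ A)).box.imp (C.imp (σ B)).box)) :=
    box_mono₂ (of_valid fun v ↦ by grind)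
  exact of_entails ((hσ.imp_trans box_right).and (int_of_box_imp hX A B)) fun v ↦ by grind

theorem boxRhd_dia {A : UFormula} (hσ : ilMinus X (A.dia.imp (σ A))) :
    ilMinus X (boxRhd σ A.dia A) :=
  of_entails (.nec hσ) fun v ↦ by grind

end ilMinus

/-- The conditions on `σ` under which reading `A ▷ B` as `□(A → σB) ∨ I B` validates `IL⁻` and
turns `⊤ ▷ B` back into `I B`, provably in `il⁻(X)`. -/
structure IsAdmissible (X : Set UFormula) (σ : UFormula → UFormula) : Prop where
  mono {A B : UFormula} : ilMinus X (A.imp B) → ilMinus X ((σ A).imp (σ B))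
  not_bot : ilMinus X (σ .bot).neg
  int_of_box (B : UFormula) : ilMinus X ((σ B).box.imp B.int)

namespace IsAdmissible

variable {X : Set UFormula} {Y : Set BFormula} {σ : UFormula → UFormula}

theorem toU_of_ILMinus (hσ : IsAdmissible X σ) (hY : ∀ F ∈ Y, ilMinus X (F.toU (boxRhd σ)))
    {F : BFormula} (hF : ILMinus Y F) : ilMinus X (F.toU (boxRhd σ)) := by
  induction hF with
  | base h =>
    rcases h with (((taut | ⟨A, B, rfl⟩) | ⟨A, rfl⟩) | ⟨A, B, C, rfl⟩) | ⟨A, rfl⟩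
    · exact .base (.inl (.inl (.inl (taut.toU _))))
    · exact .box_imp _ _
    · exact .loeb _
    · exact .boxRhd_or_left _ _ _
    · exact .box_iff_boxRhd_bot hσ.not_bot _
  | extra h => exact hY _ h
  | mp _ _ ihA ihAB => exact .mp ihA ihAB
  | nec _ ih => exact .nec ih
  | r1 C _ ih => exact .boxRhd_mono_right (hσ.mono ih) ih _
  | r2 C _ ih => exact .boxRhd_anti_left ih _

theorem ilMinus_of_toB (hσ : IsAdmissible X σ) (hY : ∀ F ∈ Y, ilMinus X (F.toU (boxRhd σ)))
    {A : UFormula} (hA : ILMinus Y A.toB) : ilMinus X A :=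
  .mp (hσ.toU_of_ILMinus hY hA)
    (.imp_of_iff (.toU_toB_iff (fun B ↦ .boxRhd_top_iff (hσ.int_of_box B)) A))

variable (X) in
theorem dia : IsAdmissible X UFormula.dia where
  mono := .dia_mono
  not_bot := .not_dia_bot
  int_of_box B := (ilMinus.box_bot_of_box_dia B).imp_trans (.int_of_box_bot B)

variable (X) in
theorem const_bot : IsAdmissible X fun _ ↦ .bot where
  mono _ := .bot_imp .bot
  not_bot := .bot_imp .bot
  int_of_box := .int_of_box_bot

theorem id (hX : uJ1 ⊆ X) : IsAdmissible X fun B ↦ B where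
  mono h := h
  not_bot := .bot_imp .bot
  int_of_box := .int_of_box hX

end IsAdmissible

section Schemata

variable {X : Set UFormula} {F : BFormula}

theorem ilMinus_toU_dia_of_mem_J5 (hF : F ∈ J5) : ilMinus X (F.toU (boxRhd .dia)) := by
  obtain ⟨A, rfl⟩ := hF
  exact .boxRhd_dia (.of_valid fun v ↦ by grind)

theorem ilMinus_toU_dia_of_mem_J4plus (hX : I2 ⊆ X) (hF : F ∈ J4plus) :
    ilMinus X (F.toU (boxRhd .dia)) := by
  obtain ⟨A, B, C, rfl⟩ := hF
  exact .boxRhd_right_of_box_imp hX (.box_dia_of_box_imp _ _) _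

theorem ilMinus_toU_bot_of_mem_J2plus (hX : I2 ⊆ X) (hF : F ∈ J2plus) :
    ilMinus X (F.toU (boxRhd fun _ ↦ .bot)) := by
  obtain ⟨A, B, C, rfl⟩ := hF
  exact .boxRhd_trans_or hX _ (.bot_imp _) (.bot_imp _) (.bot_imp _)

theorem ilMinus_toU_id_of_mem_J1_J2_J4 (hX : I2 ⊆ X) (hF : F ∈ J1 ∪ J2 ∪ J4) :
    ilMinus X (F.toU (boxRhd fun B ↦ B)) := by
  have imp_self (B : UFormula) : ilMinus X (B.imp B) := .of_valid fun v ↦ by grind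
  rcases hF with (⟨A, B, rfl⟩ | ⟨A, B, C, rfl⟩) | ⟨A, B, rfl⟩
  · exact .boxRhd_of_box_imp _ (imp_self _)
  · exact .boxRhd_trans hX _ (imp_self _) (imp_self _)
  · exact .dia_of_boxRhd hX _ (imp_self _)

end Schemata

section Conservativity

variable {A : UFormula}

theorem ilMinus_of_toB_J5 (hA : ILMinus J5 A.toB) : ilMinus ∅ A :=
  (IsAdmissible.dia ∅).ilMinus_of_toB (fun _ ↦ ilMinus_toU_dia_of_mem_J5) hA

theorem ilMinus_of_toB_J4plus_J5 (hA : ILMinus (J4plus ∪ J5) A.toB) : ilMinus I2 A :=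
  (IsAdmissible.dia I2).ilMinus_of_toB
    (fun _ hF ↦ hF.elim (ilMinus_toU_dia_of_mem_J4plus subset_rfl) ilMinus_toU_dia_of_mem_J5) hA

theorem ilMinus_of_toB_J2plus (hA : ILMinus J2plus A.toB) : ilMinus I2 A :=
  (IsAdmissible.const_bot I2).ilMinus_of_toB
    (fun _ ↦ ilMinus_toU_bot_of_mem_J2plus subset_rfl) hA

theorem ilMinus_of_toB_CL (hA : CL A.toB) : ilMinus (uJ1 ∪ I2) A :=
  (IsAdmissible.id Set.subset_union_left).ilMinus_of_toB
    (fun _ ↦ ilMinus_toU_id_of_mem_J1_J2_J4 Set.subset_union_right) hA.toILMinus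

theorem toB_of_ilMinus_empty (hA : ilMinus ∅ A) : ILMinus ∅ A.toB :=
  .toB_of_ilMinus (fun _ ↦ False.elim) hA

theorem toB_of_ilMinus_I2 (hA : ilMinus I2 A) : ILMinus J4plus A.toB :=
  .toB_of_ilMinus (fun _ ↦ .toB_I2 subset_rfl) hA

theorem toB_of_ilMinus_uJ1_I2 (hA : ilMinus (uJ1 ∪ I2) A) : ILMinus (J1 ∪ J4plus) A.toB :=
  .toB_of_ilMinus
    (fun _ hF ↦ hF.elim (.toB_uJ1 Set.subset_union_left) (.toB_I2 Set.subset_union_right)) hA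

end Conservativity

end IntLogic

theorem mainTheorem4 (A : IntLogic.UFormula) (L : Set IntLogic.BFormula) :
    (IntLogic.ILMinus ∅ ⊆ L → L ⊆ IntLogic.ILMinus IntLogic.J5 →
      (A.toB ∈ L ↔ A ∈ IntLogic.ilMinus ∅)) ∧
    ((IntLogic.ILMinus IntLogic.J4plus ⊆ L ∧
          L ⊆ IntLogic.ILMinus (IntLogic.J4plus ∪ IntLogic.J5)) ∨
        (IntLogic.ILMinus IntLogic.J4plus ⊆ L ∧ L ⊆ IntLogic.ILMinus IntLogic.J2plus) →
      (A.toB ∈ L ↔ A ∈ IntLogic.ilMinus IntLogic.I2)) ∧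
    (IntLogic.ILMinus (IntLogic.J1 ∪ IntLogic.J4plus) ⊆ L → L ⊆ IntLogic.CL →
      (A.toB ∈ L ↔ A ∈ IntLogic.ilMinus (IntLogic.uJ1 ∪ IntLogic.I2))) := by
  refine ⟨fun lower upper ↦ ?_, ?_, fun lower upper ↦ ?_⟩
  · exact ⟨fun h ↦ IntLogic.ilMinus_of_toB_J5 (upper h),
      fun h ↦ lower (IntLogic.toB_of_ilMinus_empty h)⟩
  · rintro (⟨lower, upper⟩ | ⟨lower, upper⟩)
    · exact ⟨fun h ↦ IntLogic.ilMinus_of_toB_J4plus_J5 (upper h),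
        fun h ↦ lower (IntLogic.toB_of_ilMinus_I2 h)⟩
    · exact ⟨fun h ↦ IntLogic.ilMinus_of_toB_J2plus (upper h),
        fun h ↦ lower (IntLogic.toB_of_ilMinus_I2 h)⟩
  · exact ⟨fun h ↦ IntLogic.ilMinus_of_toB_CL (upper h),
      fun h ↦ lower (IntLogic.toB_of_ilMinus_uJ1_I2 h)⟩
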